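/- Let $A,Q,A_0^i\in\mathbb R^{n\times n}$ and $B,L,B_0^i\in\mathbb R^{n\times m}$ ($i=1,\dots,r$), let $R\in\mathbb R^{m\times m}$, with $Q=Q^\top$ and $R=R^\top>0$. Write $\ge$ for the Loewner order. For $X\in\mathbb R^{n\times n}$ put $$\Pi_{11}(X)=\sum_{i=1}^r A_0^{i\top}XA_0^i,\qquad \Pi_{12}(X)=\sum_{i=1}^r A_0^{i\top}XB_0^i,\qquad \Pi_{21}(X)=\sum_{i=1}^r B_0^{i\top}XA_0^i,\qquad \Pi_{22}(X)=\sum_{i=1}^r B_0^{i\top}XB_0^i,$$ $$\Pi(X)=\begin{bmatrix}\Pi_{11}(X)&\Pi_{12}(X)\\ \Pi_{21}(X)&\Pi_{22}(X)\end{bmatrix},\qquad L_c(X)=L+\Pi_{12}(X),\qquad R_c(X)=R+\Pi_{22}(X),\qquad Q_c(X)=Q+\Pi_{11}(X),$$ and, when $R_c(X)$ is nonsingular, $$A_c(X)=A-BR_c(X)^{-1}L_c(X)^\top,\qquad G_c(X)=BR_c(X)^{-1}B^\top,\qquad H_c(X)=Q_c(X)-L_c(X)R_c(X)^{-1}L_c(X)^\top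 .$$ Let $\{X_k\}_{k\ge 0}$ be a sequence of (exact) FP-CARE\_SDA iterates: $X_0=X_0^\top\in\mathbb R^{n\times n}$ and, for every $k\ge 0$, $R_c(X_k)$ is nonsingular and $X_{k+1}$ is the stabilizing solution of $$A_c(X_k)^\top X+XA_c(X_k)-XG_c(X_k)X+H_c(X_k)=0,$$ that is, the symmetric solution for which all eigenvalues of $A_c(X_k)-G_c(X_k)X_{k+1}$ have negative real part. Assume that the sequence is monotone (either $X_k\le X_{k+1}$ for all $k$, or $X_k\ge X_{k+1}$ for all $k$) and that $\lim_{k\to\infty}X_k=\widehat X\ge 0$. Let $\widehat A=A_c(\widehat X)$, $\widehat G=G_c(\widehat X)$, $\widehat L=L_c(\widehat X)$, $\widehat R=R_c(\widehat X)$, and define on the real vector space of symmetric $n\times n$ matrices the linear operators $$\mathcal L_{\widehat X}(Z)=(\widehat A^\top-\widehat X\widehat G)Z+Z(\widehat A-\widehat G\widehat X),$$ $$\begin{aligned}\Psi_{\widehat X}(Z)={}&\bigl(\widehat L\widehat R^{-1}\Pi_{22}(Z)\widehat R^{-1}B^\top-\Pi_{12}(Z)\widehat R^{-1}B^\top\bigr)\widehat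 X+\widehat X\bigl(B\widehat R^{-1}\Pi_{22}(Z)\widehat R^{-1}\widehat L^\top-B\widehat R^{-1}\Pi_{12}(Z)^\top\bigr)\\&+\widehat XB\widehat R^{-1}\Pi_{22}(Z)\widehat R^{-1}B^\top\widehat X+\begin{bmatrix}I&-\widehat L\widehat R^{-1}\end{bmatrix}\Pi(Z)\begin{bmatrix}I\\-\widehat R^{-1}\widehat L^\top\end{bmatrix}.\end{aligned}$$ Suppose that $\mathcal L_{\widehat X}$ is invertible and that the spectral radius (over $\mathbb C$) satisfies $\rho(\mathcal L_{\widehat X}^{-1}\Psi_{\widehat X})<1$. Then $X_k\to\widehat X$ R-linearly: there is $\widehat\gamma$ with $0<\widehat\gamma<1$ such that, for every norm $\|\cdot\|$ on $\mathbb R^{n\times n}$, $$\limsup_{k\to\infty}\sqrt[k]{\|X_k-\widehat X\|}\le\widehat\gamma<1 .$$ -/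

import Mathlib

open Matrix Filter Topology

/-- Coefficients of the stochastic continuous-time algebraic Riccati equation (SCARE), with `Q`
symmetric and `R` symmetric positive definite. -/
structure SCAREData (n m r : ℕ) where
  A : Matrix (Fin n) (Fin n) ℝ
  B : Matrix (Fin n) (Fin m) ℝ
  Q : Matrix (Fin n) (Fin n) ℝ
  L : Matrix (Fin n) (Fin m) ℝ
  R : Matrix (Fin m) (Fin m) ℝ
  A₀ : Fin r → Matrix (Fin n) (Fin n) ℝ
  B₀ : Fin r → Matrix (Fin n) (Fin m) ℝ
  Q_symm : Q.IsSymm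
  R_posDef : R.PosDef

/-- The real vector space of symmetric (real Hermitian) `n × n` matrices. -/
def SymMat (n : ℕ) : Submodule ℝ (Matrix (Fin n) (Fin n) ℝ) where
  carrier := {Z | Z.IsSymm}
  add_mem' := fun ha hb => ha.add hb
  zero_mem' := Matrix.isSymm_zero
  smul_mem' := fun c _ h => h.smul c

/-- All eigenvalues of `M` (over `ℂ`) have negative real part. -/
def IsStableMatrix {n : ℕ} (M : Matrix (Fin n) (Fin n) ℝ) : Prop :=
  ∀ z ∈ spectrum ℂ (M.map (algebraMap ℝ ℂ)), z.re < 0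

/-- `Y` is a stabilizing solution of the CARE `Aᵀ Y + Y A - Y G Y + H = 0`: a symmetric solution
with `A - G Y` stable. -/
def IsStabilizingCARESolution {n : ℕ} (A G H Y : Matrix (Fin n) (Fin n) ℝ) : Prop :=
  Y.IsSymm ∧ Aᵀ * Y + Y * A - Y * G * Y + H = 0 ∧ IsStableMatrix (A - G * Y)

/-- Spectral radius of an endomorphism of a real vector space: the supremum of `|z|` over the
spectrum of its complexification. -/
noncomputable def complexSpectralRadius {V : Type*} [AddCommGroup V] [Module ℝ V]
    (T : Module.End ℝ V) : ENNReal :=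
  spectralRadius ℂ (LinearMap.baseChange ℂ T : Module.End ℂ (TensorProduct ℝ ℂ V))

namespace SCAREData

variable {n m r : ℕ} (D : SCAREData n m r)

def Pi11 (X : Matrix (Fin n) (Fin n) ℝ) : Matrix (Fin n) (Fin n) ℝ :=
  ∑ i, (D.A₀ i)ᵀ * X * D.A₀ i

def Pi12 (X : Matrix (Fin n) (Fin n) ℝ) : Matrix (Fin n) (Fin m) ℝ :=
  ∑ i, (D.A₀ i)ᵀ * X * D.B₀ i

def Pi21 (X : Matrix (Fin n) (Fin n) ℝ) : Matrix (Fin m) (Fin n) ℝ :=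
  ∑ i, (D.B₀ i)ᵀ * X * D.A₀ i

def Pi22 (X : Matrix (Fin n) (Fin n) ℝ) : Matrix (Fin m) (Fin m) ℝ :=
  ∑ i, (D.B₀ i)ᵀ * X * D.B₀ i

/-- The block operator `Π(X) = [Π₁₁(X), Π₁₂(X); Π₂₁(X), Π₂₂(X)]`, where `Π₂₁(X) = Π₁₂(X)ᵀ` for
symmetric `X`. -/
def PiBlock (X : Matrix (Fin n) (Fin n) ℝ) : Matrix (Fin n ⊕ Fin m) (Fin n ⊕ Fin m) ℝ :=
  fromBlocks (D.Pi11 X) (D.Pi12 X) (D.Pi21 X) (D.Pi22 X)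

def Lc (X : Matrix (Fin n) (Fin n) ℝ) : Matrix (Fin n) (Fin m) ℝ := D.L + D.Pi12 X

def Rc (X : Matrix (Fin n) (Fin n) ℝ) : Matrix (Fin m) (Fin m) ℝ := D.R + D.Pi22 X

def Qc (X : Matrix (Fin n) (Fin n) ℝ) : Matrix (Fin n) (Fin n) ℝ := D.Q + D.Pi11 X

noncomputable def Ac (X : Matrix (Fin n) (Fin n) ℝ) : Matrix (Fin n) (Fin n) ℝ :=
  D.A - D.B * (D.Rc X)⁻¹ * (D.Lc X)ᵀ

noncomputable def Gc (X : Matrix (Fin n) (Fin n) ℝ) : Matrix (Fin n) (Fin n) ℝ :=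
  D.B * (D.Rc X)⁻¹ * D.Bᵀ

noncomputable def Hc (X : Matrix (Fin n) (Fin n) ℝ) : Matrix (Fin n) (Fin n) ℝ :=
  D.Qc X - D.Lc X * (D.Rc X)⁻¹ * (D.Lc X)ᵀ

/-- `X` is a sequence of FP-CARE_SDA iterates: `X 0` is symmetric and, for each `k`, `R_c(X k)` is
nonsingular and `X (k+1)` is the stabilizing solution of the CARE whose coefficients are frozen
at `X k`. -/
def IsFPCARESequence (X : ℕ → Matrix (Fin n) (Fin n) ℝ) : Prop :=
  (X 0).IsSymm ∧ ∀ k, IsUnit (D.Rc (X k)).det ∧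
    IsStabilizingCARESolution (D.Ac (X k)) (D.Gc (X k)) (D.Hc (X k)) (X (k + 1))

theorem Pi11_transpose (X : Matrix (Fin n) (Fin n) ℝ) : (D.Pi11 X)ᵀ = D.Pi11 Xᵀ := by
  simp [Pi11, transpose_sum, Matrix.mul_assoc]

theorem Pi12_transpose (X : Matrix (Fin n) (Fin n) ℝ) : (D.Pi12 X)ᵀ = D.Pi21 Xᵀ := by
  simp [Pi12, Pi21, transpose_sum, Matrix.mul_assoc]

theorem Pi21_transpose (X : Matrix (Fin n) (Fin n) ℝ) : (D.Pi21 X)ᵀ = D.Pi12 Xᵀ := by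
  simp [Pi12, Pi21, transpose_sum, Matrix.mul_assoc]

theorem Pi22_transpose (X : Matrix (Fin n) (Fin n) ℝ) : (D.Pi22 X)ᵀ = D.Pi22 Xᵀ := by
  simp [Pi22, transpose_sum, Matrix.mul_assoc]

theorem PiBlock_transpose (X : Matrix (Fin n) (Fin n) ℝ) : (D.PiBlock X)ᵀ = D.PiBlock Xᵀ := by
  simp [PiBlock, fromBlocks_transpose, Pi11_transpose, Pi12_transpose, Pi21_transpose,
    Pi22_transpose]

theorem Rc_isSymm {X : Matrix (Fin n) (Fin n) ℝ} (hX : X.IsSymm) : (D.Rc X).IsSymm := by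
  have h1 : D.Rᵀ = D.R := by
    have := D.R_posDef.isHermitian.eq
    rwa [conjTranspose_eq_transpose_of_trivial] at this
  simp [Matrix.IsSymm, Rc, Pi22_transpose, hX.eq, h1]

/-- `Z ↦ (A_c(X)ᵀ - X G_c(X)) Z + Z (A_c(X) - G_c(X) X)`. -/
noncomputable def lyapFun (X Z : Matrix (Fin n) (Fin n) ℝ) : Matrix (Fin n) (Fin n) ℝ :=
  ((D.Ac X)ᵀ - X * D.Gc X) * Z + Z * (D.Ac X - D.Gc X * X)

/-- With `L = L_c(X)` and `R = R_c(X)`,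
`Z ↦ (L R⁻¹ Π₂₂(Z) R⁻¹ Bᵀ - Π₁₂(Z) R⁻¹ Bᵀ) X + X (B R⁻¹ Π₂₂(Z) R⁻¹ Lᵀ - B R⁻¹ Π₁₂(Z)ᵀ)
  + X B R⁻¹ Π₂₂(Z) R⁻¹ Bᵀ X + [I, -L R⁻¹] Π(Z) [I; -R⁻¹ Lᵀ]`. -/
noncomputable def psiFun (X Z : Matrix (Fin n) (Fin n) ℝ) : Matrix (Fin n) (Fin n) ℝ :=
  (D.Lc X * (D.Rc X)⁻¹ * D.Pi22 Z * (D.Rc X)⁻¹ * D.Bᵀ - D.Pi12 Z * (D.Rc X)⁻¹ * D.Bᵀ) * X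
  + X * (D.B * (D.Rc X)⁻¹ * D.Pi22 Z * (D.Rc X)⁻¹ * (D.Lc X)ᵀ
      - D.B * (D.Rc X)⁻¹ * (D.Pi12 Z)ᵀ)
  + X * D.B * (D.Rc X)⁻¹ * D.Pi22 Z * (D.Rc X)⁻¹ * D.Bᵀ * X
  + Matrix.fromCols (1 : Matrix (Fin n) (Fin n) ℝ) (-(D.Lc X * (D.Rc X)⁻¹)) * D.PiBlock Z
      * Matrix.fromRows (1 : Matrix (Fin n) (Fin n) ℝ) (-((D.Rc X)⁻¹ * (D.Lc X)ᵀ))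

theorem lyapFun_isSymm {X Z : Matrix (Fin n) (Fin n) ℝ} (hX : X.IsSymm) (hZ : Z.IsSymm) :
    (D.lyapFun X Z).IsSymm := by
  have hR : ((D.Rc X)⁻¹)ᵀ = (D.Rc X)⁻¹ := by rw [transpose_nonsing_inv, (D.Rc_isSymm hX).eq]
  have hG : (D.Gc X)ᵀ = D.Gc X := by simp [Gc, hR, Matrix.mul_assoc]
  simp only [Matrix.IsSymm, lyapFun, transpose_add, transpose_mul, transpose_sub,
    transpose_transpose, hX.eq, hZ.eq, hG]
  rw [add_comm]

theorem psiFun_isSymm {X Z : Matrix (Fin n) (Fin n) ℝ} (hX : X.IsSymm) (hZ : Z.IsSymm) :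
    (D.psiFun X Z).IsSymm := by
  have hR : ((D.Rc X)⁻¹)ᵀ = (D.Rc X)⁻¹ := by rw [transpose_nonsing_inv, (D.Rc_isSymm hX).eq]
  simp only [Matrix.IsSymm, psiFun, transpose_add, transpose_mul, transpose_sub,
    transpose_transpose, hX.eq, hR, transpose_fromCols, transpose_fromRows, transpose_neg,
    transpose_one, PiBlock_transpose, Pi22_transpose, hZ.eq, Matrix.mul_assoc]
  abel

theorem Pi11_add (Z W : Matrix (Fin n) (Fin n) ℝ) : D.Pi11 (Z + W) = D.Pi11 Z + D.Pi11 W := by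
  simp [Pi11, Matrix.mul_add, Matrix.add_mul, Finset.sum_add_distrib]

theorem Pi12_add (Z W : Matrix (Fin n) (Fin n) ℝ) : D.Pi12 (Z + W) = D.Pi12 Z + D.Pi12 W := by
  simp [Pi12, Matrix.mul_add, Matrix.add_mul, Finset.sum_add_distrib]

theorem Pi21_add (Z W : Matrix (Fin n) (Fin n) ℝ) : D.Pi21 (Z + W) = D.Pi21 Z + D.Pi21 W := by
  simp [Pi21, Matrix.mul_add, Matrix.add_mul, Finset.sum_add_distrib]

theorem Pi22_add (Z W : Matrix (Fin n) (Fin n) ℝ) : D.Pi22 (Z + W) = D.Pi22 Z + D.Pi22 W := by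
  simp [Pi22, Matrix.mul_add, Matrix.add_mul, Finset.sum_add_distrib]

theorem Pi11_smul (c : ℝ) (Z : Matrix (Fin n) (Fin n) ℝ) : D.Pi11 (c • Z) = c • D.Pi11 Z := by
  simp [Pi11, Finset.smul_sum]

theorem Pi12_smul (c : ℝ) (Z : Matrix (Fin n) (Fin n) ℝ) : D.Pi12 (c • Z) = c • D.Pi12 Z := by
  simp [Pi12, Finset.smul_sum]

theorem Pi21_smul (c : ℝ) (Z : Matrix (Fin n) (Fin n) ℝ) : D.Pi21 (c • Z) = c • D.Pi21 Z := by
  simp [Pi21, Finset.smul_sum]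

theorem Pi22_smul (c : ℝ) (Z : Matrix (Fin n) (Fin n) ℝ) : D.Pi22 (c • Z) = c • D.Pi22 Z := by
  simp [Pi22, Finset.smul_sum]

theorem PiBlock_add (Z W : Matrix (Fin n) (Fin n) ℝ) :
    D.PiBlock (Z + W) = D.PiBlock Z + D.PiBlock W := by
  simp [PiBlock, fromBlocks_add, Pi11_add, Pi12_add, Pi21_add, Pi22_add]

theorem PiBlock_smul (c : ℝ) (Z : Matrix (Fin n) (Fin n) ℝ) :
    D.PiBlock (c • Z) = c • D.PiBlock Z := by
  simp [PiBlock, fromBlocks_smul, Pi11_smul, Pi12_smul, Pi21_smul, Pi22_smul]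

/-- The operator `𝓛_X` on symmetric matrices. -/
noncomputable def lyapOp (X : SymMat n) : Module.End ℝ (SymMat n) where
  toFun Z := ⟨D.lyapFun X Z, D.lyapFun_isSymm X.2 Z.2⟩
  map_add' Z W := by
    apply Subtype.ext
    simp only [lyapFun, Submodule.coe_add, Matrix.mul_add, Matrix.add_mul]
    abel
  map_smul' c Z := by
    apply Subtype.ext
    simp [lyapFun, smul_add]

/-- The operator `Ψ_X` on symmetric matrices. -/
noncomputable def psiOp (X : SymMat n) : Module.End ℝ (SymMat n) where
  toFun Z := ⟨D.psiFun X Z, D.psiFun_isSymm X.2 Z.2⟩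
  map_add' Z W := by
    apply Subtype.ext
    simp only [psiFun, Submodule.coe_add, Pi12_add, Pi22_add, PiBlock_add, Matrix.mul_add,
      Matrix.add_mul, Matrix.mul_sub, Matrix.sub_mul, transpose_add]
    abel
  map_smul' c Z := by
    apply Subtype.ext
    simp only [psiFun, Submodule.coe_smul, Pi12_smul, Pi22_smul, PiBlock_smul, Matrix.mul_smul,
      Matrix.smul_mul, Matrix.mul_sub, Matrix.sub_mul, transpose_smul, smul_add, smul_sub,
      RingHom.id_apply]

end SCAREData

/-! Let `F` be the feedback matrix at the limit `Xhat`. The frozen CARE residual is affine in the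
unknown and in the frozen point, apart from one term `Sᵀ R_c⁻¹ S`. Completing the square in that
term around `F` gives the exact identity `careResidual_add`: for errors `Z` (frozen point) and `W`
(unknown), the residual is its value at `Xhat` plus `𝓛 W + Ψ Z - Eᵀ R_c(Xhat + Z)⁻¹ E`, with `E`
linear in `(Z, W)`. The residual vanishes along the iterates and, by continuity, at `Xhat`. Hence
the errors satisfy `e (k+1) = w k - 𝓛⁻¹Ψ (e k)`, where `w k` is quadratic in `(e k, e (k+1))`. Since
the spectral radius of `𝓛⁻¹Ψ` is below one, some equivalent norm is contracted by it
(`exists_adapted_norm`). As `e k → 0`, the quadratic term, though implicit in `e (k+1)`, is absorbed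
(`exists_geometric_bound`), and the decay is geometric. -/

namespace SCAREData

/-! ### Exact second-order expansion of the CARE residual. -/

variable {n m r : ℕ} (D : SCAREData n m r)

/-- The left-hand side of the CARE with coefficients frozen at `Y`. -/
noncomputable def careResidual (Y X : Matrix (Fin n) (Fin n) ℝ) : Matrix (Fin n) (Fin n) ℝ :=
  (D.Ac Y)ᵀ * X + X * D.Ac Y - X * D.Gc Y * X + D.Hc Y

/-- The feedback matrix `R_c(X)⁻¹ (X B + L_c(X))ᵀ`. -/
noncomputable def feedback (X : Matrix (Fin n) (Fin n) ℝ) : Matrix (Fin m) (Fin n) ℝ :=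
  (D.Rc X)⁻¹ * (D.Bᵀ * X + (D.Lc X)ᵀ)

/-- The linear form in the errors `Z`, `W` whose square is the remainder of the CARE residual. -/
noncomputable def defect (X Z W : Matrix (Fin n) (Fin n) ℝ) : Matrix (Fin m) (Fin n) ℝ :=
  D.Bᵀ * W + D.Pi21 Z - D.Pi22 Z * D.feedback X

theorem Rc_inv_transpose {X : Matrix (Fin n) (Fin n) ℝ} (hX : X.IsSymm) :
    ((D.Rc X)⁻¹)ᵀ = (D.Rc X)⁻¹ := by
  rw [transpose_nonsing_inv, (D.Rc_isSymm hX).eq]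

theorem careResidual_eq {Y X : Matrix (Fin n) (Fin n) ℝ} (hY : Y.IsSymm) (hX : X.IsSymm) :
    D.careResidual Y X = D.Aᵀ * X + X * D.A + D.Qc Y
      - (D.Bᵀ * X + (D.Lc Y)ᵀ)ᵀ * (D.Rc Y)⁻¹ * (D.Bᵀ * X + (D.Lc Y)ᵀ) := by
  simp only [careResidual, Ac, Gc, Hc, transpose_sub, transpose_add, transpose_mul,
    transpose_transpose, D.Rc_inv_transpose hY, hX.eq, Matrix.mul_add, Matrix.add_mul,
    Matrix.mul_sub, Matrix.sub_mul, Matrix.mul_assoc]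
  abel

/-- `K` is a guess for `R⁻¹ S` and `M` its defect. `R⁻¹` survives only in the term quadratic in `M`,
so no expansion of an inverse is needed. -/
theorem complete_square {S K M : Matrix (Fin m) (Fin n) ℝ} {R : Matrix (Fin m) (Fin m) ℝ}
    (hR : IsUnit R.det) (hRs : R.IsSymm) (hS : S = R * K + M) :
    Sᵀ * R⁻¹ * S = Kᵀ * R * K + Kᵀ * M + Mᵀ * K + Mᵀ * R⁻¹ * M := by
  have h1 : ∀ N : Matrix (Fin m) (Fin n) ℝ, R * (R⁻¹ * N) = N := fun N => by
    rw [← Matrix.mul_assoc, mul_nonsing_inv _ hR, Matrix.one_mul]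
  have h2 : ∀ N : Matrix (Fin m) (Fin n) ℝ, R⁻¹ * (R * N) = N := fun N => by
    rw [← Matrix.mul_assoc, nonsing_inv_mul _ hR, Matrix.one_mul]
  simp only [hS, transpose_add, transpose_mul, hRs.eq, Matrix.mul_add, Matrix.add_mul,
    Matrix.mul_assoc, h1, h2]
  abel

/-- The square is completed with the same `K = feedback X` at `X` and at `X + Z`; at `X` the defect
is zero. The terms linear in the errors then assemble into `lyapFun` and `psiFun`. -/
theorem careResidual_add {X Z W : Matrix (Fin n) (Fin n) ℝ} (hX : X.IsSymm) (hZ : Z.IsSymm)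
    (hW : W.IsSymm) (hR : IsUnit (D.Rc X).det) (hR' : IsUnit (D.Rc (X + Z)).det) :
    D.careResidual (X + Z) (X + W) = D.careResidual X X + D.lyapFun X W + D.psiFun X Z
      - (D.defect X Z W)ᵀ * (D.Rc (X + Z))⁻¹ * D.defect X Z W := by
  have hK : D.Rc X * D.feedback X = D.Bᵀ * X + (D.Lc X)ᵀ := by
    rw [feedback, ← Matrix.mul_assoc, mul_nonsing_inv _ hR, Matrix.one_mul]
  have hRadd : D.Rc (X + Z) = D.Rc X + D.Pi22 Z := by simp only [Rc, Pi22_add]; abel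
  have hLadd : D.Lc (X + Z) = D.Lc X + D.Pi12 Z := by simp only [Lc, Pi12_add]; abel
  have hQadd : D.Qc (X + Z) = D.Qc X + D.Pi11 Z := by simp only [Qc, Pi11_add]; abel
  have hP : (D.Pi12 Z)ᵀ = D.Pi21 Z := by rw [Pi12_transpose, hZ.eq]
  have hP' : (D.Pi21 Z)ᵀ = D.Pi12 Z := by rw [Pi21_transpose, hZ.eq]
  have hP2 : (D.Pi22 Z)ᵀ = D.Pi22 Z := by rw [Pi22_transpose, hZ.eq]
  have hS : D.Bᵀ * (X + W) + (D.Lc (X + Z))ᵀ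
      = D.Rc (X + Z) * D.feedback X + D.defect X Z W := by
    rw [hRadd, Matrix.add_mul, hK, defect, hLadd, transpose_add, hP, Matrix.mul_add]; abel
  have hS0 : D.Bᵀ * X + (D.Lc X)ᵀ = D.Rc X * D.feedback X + 0 := by rw [hK, add_zero]
  have hPsi : D.psiFun X Z = D.Pi11 Z - D.Pi12 Z * D.feedback X - (D.feedback X)ᵀ * D.Pi21 Z
      + (D.feedback X)ᵀ * D.Pi22 Z * D.feedback X := by
    simp only [psiFun, PiBlock, fromCols_mul_fromBlocks, fromCols_mul_fromRows, feedback, hP,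
      transpose_add, transpose_mul, transpose_transpose, D.Rc_inv_transpose hX, hX.eq,
      Matrix.mul_add, Matrix.add_mul, Matrix.mul_sub, Matrix.sub_mul, Matrix.mul_assoc,
      Matrix.one_mul, Matrix.mul_one, Matrix.mul_neg, Matrix.neg_mul]
    abel
  have hLyap : D.lyapFun X W = D.Aᵀ * W + W * D.A - (D.feedback X)ᵀ * D.Bᵀ * W
      - W * D.B * D.feedback X := by
    simp only [lyapFun, Ac, Gc, feedback,
      transpose_add, transpose_sub, transpose_mul, transpose_transpose, D.Rc_inv_transpose hX,
      hX.eq, Matrix.mul_add, Matrix.add_mul, Matrix.mul_sub, Matrix.sub_mul, Matrix.mul_assoc]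
    abel
  rw [D.careResidual_eq (hX.add hZ) (hX.add hW), D.careResidual_eq hX hX,
    complete_square hR' (D.Rc_isSymm (hX.add hZ)) hS,
    complete_square hR (D.Rc_isSymm hX) hS0, hPsi, hLyap]
  have e1 : (D.feedback X)ᵀ * D.defect X Z W = (D.feedback X)ᵀ * D.Bᵀ * W
      + (D.feedback X)ᵀ * D.Pi21 Z - (D.feedback X)ᵀ * D.Pi22 Z * D.feedback X := by
    simp only [defect, Matrix.mul_add, Matrix.mul_sub, Matrix.mul_assoc]
  have e2 : (D.defect X Z W)ᵀ * D.feedback X = W * D.B * D.feedback X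
      + D.Pi12 Z * D.feedback X - (D.feedback X)ᵀ * D.Pi22 Z * D.feedback X := by
    simp only [defect, transpose_add, transpose_sub, transpose_mul, transpose_transpose, hW.eq,
      hP', hP2, Matrix.add_mul, Matrix.sub_mul, Matrix.mul_assoc]
  rw [e1, e2, hRadd, hQadd]
  simp only [Matrix.mul_add, Matrix.add_mul, Matrix.mul_zero, transpose_zero, Matrix.zero_mul]
  abel

/-! ### Positivity of `R_c` and continuity of its inverse. -/

theorem continuous_Pi22 : Continuous D.Pi22 := by
  unfold Pi22
  fun_prop

theorem continuous_Rc : Continuous D.Rc :=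
  continuous_const.add D.continuous_Pi22

theorem Rc_posDef {X : Matrix (Fin n) (Fin n) ℝ} (hX : X.PosSemidef) : (D.Rc X).PosDef := by
  refine D.R_posDef.add_posSemidef ?_
  refine posSemidef_sum _ fun i _ => ?_
  simpa using hX.conjTranspose_mul_mul_same (D.B₀ i)

theorem tendsto_Rc_inv {X : ℕ → Matrix (Fin n) (Fin n) ℝ} {Y : Matrix (Fin n) (Fin n) ℝ}
    (hY : IsUnit (D.Rc Y).det) (hX : Tendsto X atTop (𝓝 Y)) :
    Tendsto (fun k => (D.Rc (X k))⁻¹) atTop (𝓝 (D.Rc Y)⁻¹) := by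
  have h : Tendsto (fun k => D.Rc (X k)) atTop (𝓝 (D.Rc Y)) := (D.continuous_Rc.tendsto Y).comp hX
  simp only [Matrix.inv_def, Ring.inverse_eq_inv']
  exact (((continuous_id.matrix_det.tendsto _).comp h).inv₀ hY.ne_zero).smul
    ((continuous_id.matrix_adjugate.tendsto _).comp h)

end SCAREData

/-! ### Finite-dimensional bounds and adapted norms. -/

theorem Seminorm.exists_bound_of_finiteDimensional {V : Type*} [NormedAddCommGroup V]
    [NormedSpace ℝ V] [FiniteDimensional ℝ V] (N : Seminorm ℝ V) :
    ∃ C : ℝ, 0 < C ∧ ∀ x, N x ≤ C * ‖x‖ :=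
  N.bound_of_continuous_normedSpace N.convexOn.locallyLipschitz.continuous

theorem LinearMap.exists_bound_of_finiteDimensional {V W : Type*} [NormedAddCommGroup V]
    [NormedSpace ℝ V] [FiniteDimensional ℝ V] [NormedAddCommGroup W] [NormedSpace ℝ W]
    (f : V →ₗ[ℝ] W) : ∃ C : ℝ, 0 < C ∧ ∀ x, ‖f x‖ ≤ C * ‖x‖ :=
  ((normSeminorm ℝ W).comp f).exists_bound_of_finiteDimensional

section AdaptedNorm

variable {V : Type*} [AddCommGroup V] [Module ℝ V]

attribute [local instance] Matrix.linftyOpNormedAddCommGroup Matrix.linftyOpNormedRing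
  Matrix.linftyOpNormedAlgebra

/-- Moves the spectral radius to complex matrices, a Banach algebra where Gelfand's formula applies.
-/
theorem spectralRadius_toMatrix_baseChange {ι : Type*} [Fintype ι] [DecidableEq ι]
    (b : Module.Basis ι ℝ V) (T : Module.End ℝ V) :
    spectralRadius ℂ ((LinearMap.toMatrix b b T).map (algebraMap ℝ ℂ))
      = complexSpectralRadius T := by
  have h := AlgEquiv.spectrum_eq (LinearMap.toMatrixAlgEquiv (Algebra.TensorProduct.basis ℂ b))
    (LinearMap.baseChange ℂ T : Module.End ℂ (TensorProduct ℝ ℂ V))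
  have h2 : LinearMap.toMatrixAlgEquiv (Algebra.TensorProduct.basis ℂ b) (LinearMap.baseChange ℂ T)
      = (LinearMap.toMatrix b b T).map (algebraMap ℝ ℂ) :=
    LinearMap.toMatrix_baseChange ℂ T b b
  rw [complexSpectralRadius, spectralRadius, spectralRadius, ← h2, h]

theorem exists_pow_nnnorm_le {A : Type*} [NormedRing A] [NormedAlgebra ℂ A] [CompleteSpace A]
    {a : A} (ha : spectralRadius ℂ a < 1) :
    ∃ N : ℕ, 0 < N ∧ ∃ s : ℝ, 0 < s ∧ s < 1 ∧ ‖a ^ N‖ ≤ s ^ N := by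
  obtain ⟨s, hs1, hs2⟩ := ENNReal.lt_iff_exists_nnreal_btwn.1 ha
  have h := (spectrum.pow_nnnorm_pow_one_div_tendsto_nhds_spectralRadius a).eventually_lt_const hs1
  obtain ⟨N, hN, hN0⟩ := (h.and (eventually_gt_atTop 0)).exists
  have hs0 : (0 : ENNReal) < s := lt_of_le_of_lt (zero_le) hs1
  refine ⟨N, hN0, s, by exact_mod_cast hs0, by exact_mod_cast hs2, ?_⟩
  have hN' : (0 : ℝ) < N := by exact_mod_cast hN0
  have h2 := ENNReal.rpow_le_rpow hN.le hN'.le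
  rw [← ENNReal.rpow_mul, one_div_mul_cancel hN'.ne', ENNReal.rpow_one, ENNReal.rpow_natCast] at h2
  exact_mod_cast h2

theorem linftyOpNorm_map_algebraMap {ι : Type*} [Fintype ι] (M : Matrix ι ι ℝ) :
    ‖M.map (algebraMap ℝ ℂ)‖ = ‖M‖ := by
  simp [Matrix.linfty_opNorm_def]

/-- A linear endomorphism of a finite-dimensional real space with spectral radius less than one
contracts some norm equivalent to the given one. -/
theorem exists_adapted_norm {V : Type*} [NormedAddCommGroup V] [NormedSpace ℝ V]
    [FiniteDimensional ℝ V] (T : Module.End ℝ V) (hT : complexSpectralRadius T < 1) :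
    ∃ p : Seminorm ℝ V, ∃ s c C : ℝ, 0 < s ∧ s < 1 ∧ 0 < c ∧ 0 < C ∧
      (∀ x, p (T x) ≤ s * p x) ∧ (∀ x, c * ‖x‖ ≤ p x) ∧ ∀ x, p x ≤ C * ‖x‖ := by
  classical
  let b := Module.finBasis ℝ V
  rw [← spectralRadius_toMatrix_baseChange b] at hT
  obtain ⟨N, hN, s, hs0, hs1, h⟩ := exists_pow_nnnorm_le hT
  have hpow : ((LinearMap.toMatrix b b T).map (algebraMap ℝ ℂ)) ^ N
      = (LinearMap.toMatrix b b (T ^ N)).map (algebraMap ℝ ℂ) := by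
    rw [show LinearMap.toMatrix b b (T ^ N) = LinearMap.toMatrix b b T ^ N from
      (LinearMap.toMatrix_pow b T N).symm]
    exact (Matrix.map_pow (LinearMap.toMatrix b b T) (algebraMap ℝ ℂ) N).symm
  rw [hpow, linftyOpNorm_map_algebraMap] at h
  let q : Seminorm ℝ V := (normSeminorm ℝ (Fin (Module.finrank ℝ V) → ℝ)).comp b.equivFun.toLinearMap
  have hq : ∀ x, q x = ‖b.equivFun x‖ := fun x => rfl
  have hTq : ∀ x, q ((T ^ N) x) ≤ s ^ N * q x := by
    intro x
    have e : b.equivFun ((T ^ N) x) = LinearMap.toMatrix b b (T ^ N) *ᵥ b.equivFun x :=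
      (LinearMap.toMatrix_mulVec_repr b b (T ^ N) x).symm
    rw [hq, hq, e]
    exact (Matrix.linfty_opNorm_mulVec _ _).trans (by gcongr)
  let e := b.equivFun.toContinuousLinearEquiv
  -- The weights `s⁻ʲ` make `p (T x)` an index shift of `p x`, scaled by `s`; the new last term is
  -- at most the dropped first one because `q (T^N x) ≤ s^N q x`.
  let p : Seminorm ℝ V := Seminorm.of
    (fun x => ∑ j ∈ Finset.range N, s⁻¹ ^ j * q ((T ^ j) x))
    (fun x y => by
      rw [← Finset.sum_add_distrib]
      refine Finset.sum_le_sum fun j _ => ?_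
      rw [map_add, ← mul_add]
      exact mul_le_mul_of_nonneg_left (map_add_le_add q _ _) (by positivity))
    (fun a x => by
      rw [Finset.mul_sum]
      refine Finset.sum_congr rfl fun j _ => ?_
      rw [map_smul, map_smul_eq_mul, mul_left_comm])
  have hp : ∀ x, p x = ∑ j ∈ Finset.range N, s⁻¹ ^ j * q ((T ^ j) x) := fun x => rfl
  have hle : ∀ x, q x ≤ p x := by
    intro x
    rw [hp]
    have := Finset.single_le_sum (f := fun j => s⁻¹ ^ j * q ((T ^ j) x))
      (fun j _ => by positivity) (Finset.mem_range.2 hN)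
    simpa using this
  obtain ⟨C, hC, hpC⟩ := p.exists_bound_of_finiteDimensional
  have hsymm := (e.symm : (Fin (Module.finrank ℝ V) → ℝ) →L[ℝ] V).le_opNorm
  set B := ‖(e.symm : (Fin (Module.finrank ℝ V) → ℝ) →L[ℝ] V)‖
  -- `B + 1` instead of `B`, since `B = 0` when `V` is trivial.
  refine ⟨p, s, (B + 1)⁻¹, C, hs0, hs1, by positivity, hC, ?_, ?_, hpC⟩
  · intro x
    have key : p (T x) = s * (p x - q x + s⁻¹ ^ N * q ((T ^ N) x)) := by
      have h1 := Finset.sum_range_succ (fun j => s⁻¹ ^ j * q ((T ^ j) x)) N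
      rw [Finset.sum_range_succ', ← hp x] at h1
      have h2 : p x - q x + s⁻¹ ^ N * q ((T ^ N) x)
          = ∑ k ∈ Finset.range N, s⁻¹ ^ (k + 1) * q ((T ^ (k + 1)) x) := by
        simp only [pow_zero, one_mul, Module.End.one_apply] at h1
        linarith
      rw [h2, hp, Finset.mul_sum]
      refine Finset.sum_congr rfl fun j _ => ?_
      rw [pow_succ T j, Module.End.mul_apply, pow_succ]
      field_simp
    rw [key]
    have h3 : s⁻¹ ^ N * q ((T ^ N) x) ≤ q x := by
      have := mul_le_mul_of_nonneg_left (hTq x) (show 0 ≤ s⁻¹ ^ N by positivity)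
      rwa [← mul_assoc, ← mul_pow, inv_mul_cancel₀ hs0.ne', one_pow, one_mul] at this
    gcongr
    linarith
  · intro x
    refine le_trans ?_ (hle x)
    rw [inv_mul_le_iff₀ (by positivity), hq]
    have h1 := hsymm (e x)
    rw [ContinuousLinearEquiv.coe_coe, e.symm_apply_apply] at h1
    have h3 : ‖e x‖ = ‖b.equivFun x‖ := rfl
    rw [h3] at h1
    nlinarith [norm_nonneg (b.equivFun x)]

end AdaptedNorm

/-! ### Perturbed linear recursions and root rates. -/

/-- A sequence tending to zero that satisfies a linear recursion with spectral radius less than one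
up to a quadratic implicit perturbation converges geometrically. -/
theorem exists_geometric_bound {V : Type*} [NormedAddCommGroup V] [NormedSpace ℝ V]
    [FiniteDimensional ℝ V] (T : Module.End ℝ V) (hT : complexSpectralRadius T < 1)
    {e w : ℕ → V} {K : ℝ} (he : Tendsto e atTop (𝓝 0))
    (hrec : ∀ k, e (k + 1) = w k - T (e k))
    (hw : ∀ᶠ k in atTop, ‖w k‖ ≤ K * (‖e k‖ + ‖e (k + 1)‖) ^ 2) :
    ∃ γ C : ℝ, 0 < γ ∧ γ < 1 ∧ 0 < C ∧ ∀ᶠ k in atTop, ‖e k‖ ≤ C * γ ^ k := by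
  obtain ⟨p, s, c, C, hs0, hs1, hc, hC, hTp, hcp, hpC⟩ := exists_adapted_norm T hT
  obtain ⟨γ, hsγ, hγ1⟩ := exists_between hs1
  have hγ0 : 0 < γ := hs0.trans hsγ
  -- This `ε` solves `(s + ε) / (1 - ε) = γ`, the rate left after moving the implicit term to the
  -- left.
  have hε : 0 < (γ - s) / (1 + γ) := div_pos (sub_pos.2 hsγ) (by linarith)
  set ε := (γ - s) / (1 + γ) with hεdef
  have hεeq : ε * (1 + γ) = γ - s := div_mul_cancel₀ _ (by linarith)
  have hsmall : Tendsto (fun k => C * K * c⁻¹ * (‖e k‖ + ‖e (k + 1)‖)) atTop (𝓝 0) := by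
    have h1 := he.norm
    have h2 := (he.comp (tendsto_add_atTop_nat 1)).norm
    simpa using (h1.add h2).const_mul (C * K * c⁻¹)
  have hstep : ∀ᶠ k in atTop, p (e (k + 1)) ≤ γ * p (e k) := by
    filter_upwards [hw, hsmall.eventually_lt_const hε] with k hwk hk
    have h1 : p (e (k + 1)) ≤ p (w k) + p (T (e k)) := by
      rw [hrec]; exact map_sub_le_add p _ _
    have ha : ‖e k‖ + ‖e (k + 1)‖ ≤ c⁻¹ * (p (e k) + p (e (k + 1))) := by
      rw [le_inv_mul_iff₀ hc]; linarith [hcp (e k), hcp (e (k + 1))]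
    -- One factor of the square is small because `e` tends to zero; the other stays linear.
    have h2 : p (w k) ≤ ε * (p (e k) + p (e (k + 1))) := by
      calc p (w k) ≤ C * ‖w k‖ := hpC _
        _ ≤ C * (K * (‖e k‖ + ‖e (k + 1)‖) ^ 2) := by gcongr
        _ = (C * K * c⁻¹ * (‖e k‖ + ‖e (k + 1)‖)) * (c * (‖e k‖ + ‖e (k + 1)‖)) := by
          field_simp
        _ ≤ ε * (c * (‖e k‖ + ‖e (k + 1)‖)) := by gcongr
        _ ≤ ε * (c * (c⁻¹ * (p (e k) + p (e (k + 1))))) := by gcongr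
        _ = _ := by rw [mul_inv_cancel_left₀ hc.ne']
    have h3 := hTp (e k)
    have h5 : ε < 1 := by nlinarith
    have h6 : (1 - ε) * p (e (k + 1)) ≤ (1 - ε) * (γ * p (e k)) := by
      have : (1 - ε) * γ = s + ε := by linarith
      rw [← mul_assoc, this]; linarith
    exact le_of_mul_le_mul_left h6 (by linarith)
  obtain ⟨k₀, hk₀⟩ := eventually_atTop.1 hstep
  have hgeo : ∀ j, p (e (k₀ + j)) ≤ γ ^ j * p (e k₀) := by
    intro j
    induction j with
    | zero => simp
    | succ j ih =>
      calc p (e (k₀ + j + 1)) ≤ γ * p (e (k₀ + j)) := hk₀ _ (by omega)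
        _ ≤ γ * (γ ^ j * p (e k₀)) := by gcongr
        _ = _ := by ring
  -- The `+ 1` keeps the constant positive if `p (e k₀) = 0`.
  refine ⟨γ, c⁻¹ * (γ ^ k₀)⁻¹ * p (e k₀) + 1, hγ0, hγ1, by positivity, ?_⟩
  filter_upwards [eventually_ge_atTop k₀] with k hk
  obtain ⟨j, rfl⟩ := Nat.exists_eq_add_of_le hk
  have h1 : ‖e (k₀ + j)‖ ≤ c⁻¹ * (γ ^ j * p (e k₀)) := by
    rw [le_inv_mul_iff₀ hc]; exact (hcp _).trans (hgeo j)
  calc ‖e (k₀ + j)‖ ≤ c⁻¹ * (γ ^ j * p (e k₀)) := h1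
    _ = c⁻¹ * (γ ^ k₀)⁻¹ * p (e k₀) * γ ^ (k₀ + j) := by rw [pow_add]; field_simp
    _ ≤ _ := by gcongr; linarith

/-- A geometric bound controls the root limit superior. -/
theorem limsup_root_le {u : ℕ → ℝ} {C γ : ℝ} (hC : 0 < C) (hγ : 0 < γ) (hu : ∀ k, 0 ≤ u k)
    (h : ∀ᶠ k in atTop, u k ≤ C * γ ^ k) :
    limsup (fun k : ℕ => ((u k ^ (1 / (k : ℝ)) : ℝ) : EReal)) atTop ≤ (γ : EReal) := by
  have hlim : Tendsto (fun k : ℕ => ((C ^ (1 / (k : ℝ)) * γ : ℝ) : EReal)) atTop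
      (𝓝 (γ : EReal)) := by
    refine (continuous_coe_real_ereal.tendsto γ).comp ?_
    have h1 : Tendsto (fun k : ℕ => C ^ (1 / (k : ℝ))) atTop (𝓝 (C ^ (0 : ℝ))) :=
      tendsto_const_nhds.rpow tendsto_one_div_atTop_nhds_zero_nat (Or.inl hC.ne')
    simpa using h1.mul_const γ
  rw [← hlim.limsup_eq]
  -- `EReal` is a complete lattice, so the boundedness side conditions are automatic.
  refine limsup_le_limsup ?_
  filter_upwards [h, eventually_gt_atTop 0] with k hk hk0
  have hk0' : (k : ℝ) ≠ 0 := by positivity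
  refine EReal.coe_le_coe_iff.2 ?_
  calc u k ^ (1 / (k : ℝ)) ≤ (C * γ ^ k) ^ (1 / (k : ℝ)) :=
        Real.rpow_le_rpow (hu k) hk (by positivity)
    _ = C ^ (1 / (k : ℝ)) * γ := by
      rw [Real.mul_rpow hC.le (by positivity), ← Real.rpow_natCast γ k, ← Real.rpow_mul hγ.le,
        mul_one_div_cancel hk0', Real.rpow_one]
-- Application to the FP-CARE_SDA errors.
namespace SCAREData

variable {n m r : ℕ} (D : SCAREData n m r)

attribute [local instance] Matrix.frobeniusNormedAddCommGroup Matrix.frobeniusNormedSpace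

/-- `defect` as a linear map in the pair of errors. -/
noncomputable def defectLin (X : Matrix (Fin n) (Fin n) ℝ) :
    Matrix (Fin n) (Fin n) ℝ × Matrix (Fin n) (Fin n) ℝ →ₗ[ℝ] Matrix (Fin m) (Fin n) ℝ where
  toFun P := D.defect X P.1 P.2
  map_add' P P' := by
    simp only [defect, Prod.fst_add, Prod.snd_add, Pi21_add, Pi22_add, Matrix.mul_add,
      Matrix.add_mul]
    abel
  map_smul' c P := by
    simp only [defect, Prod.smul_fst, Prod.smul_snd, Pi21_smul, Pi22_smul, Matrix.mul_smul,
      Matrix.smul_mul, smul_add, smul_sub, RingHom.id_apply]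

theorem exists_norm_defect_le (X : Matrix (Fin n) (Fin n) ℝ) :
    ∃ C : ℝ, 0 ≤ C ∧ ∀ Z W, ‖D.defect X Z W‖ ≤ C * (‖Z‖ + ‖W‖) := by
  obtain ⟨C, hC, hf⟩ := (D.defectLin X).exists_bound_of_finiteDimensional
  refine ⟨C, hC.le, fun Z W => (hf (Z, W)).trans ?_⟩
  gcongr
  rw [Prod.norm_mk]
  exact max_le_add_of_nonneg (norm_nonneg _) (norm_nonneg _)

theorem isSymm_of_isFPCARESequence {X : ℕ → Matrix (Fin n) (Fin n) ℝ}
    (hX : D.IsFPCARESequence X) (k : ℕ) : (X k).IsSymm := by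
  cases k with
  | zero => exact hX.1
  | succ k => exact (hX.2 k).2.1

theorem careResidual_succ {X : ℕ → Matrix (Fin n) (Fin n) ℝ}
    (hX : D.IsFPCARESequence X) (k : ℕ) : D.careResidual (X k) (X (k + 1)) = 0 :=
  (hX.2 k).2.2.1

/-- `(R_c (X k))⁻¹` converges, so its norm is eventually below that of the limit plus one. The
Frobenius norm is submultiplicative on rectangular products and invariant under transposition. -/
theorem exists_norm_remainder_le {X : ℕ → Matrix (Fin n) (Fin n) ℝ}
    {Y : Matrix (Fin n) (Fin n) ℝ} (hY : IsUnit (D.Rc Y).det) (hX : Tendsto X atTop (𝓝 Y)) :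
    ∃ K : ℝ, 0 ≤ K ∧ ∀ᶠ k in atTop, ∀ Z W,
      ‖(D.defect Y Z W)ᵀ * (D.Rc (X k))⁻¹ * D.defect Y Z W‖ ≤ K * (‖Z‖ + ‖W‖) ^ 2 := by
  obtain ⟨C, hC, hd⟩ := D.exists_norm_defect_le Y
  have h := (D.tendsto_Rc_inv hY hX).norm.eventually_lt_const (lt_add_one _)
  refine ⟨C * (‖(D.Rc Y)⁻¹‖ + 1) * C, by positivity, h.mono fun k hk Z W => ?_⟩
  calc ‖(D.defect Y Z W)ᵀ * (D.Rc (X k))⁻¹ * D.defect Y Z W‖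
      ≤ ‖(D.defect Y Z W)ᵀ‖ * ‖(D.Rc (X k))⁻¹‖ * ‖D.defect Y Z W‖ :=
        (frobenius_norm_mul _ _).trans
          (mul_le_mul_of_nonneg_right (frobenius_norm_mul _ _) (norm_nonneg _))
    _ ≤ (C * (‖Z‖ + ‖W‖)) * (‖(D.Rc Y)⁻¹‖ + 1) * (C * (‖Z‖ + ‖W‖)) := by
        rw [frobenius_norm_transpose]
        gcongr <;> exact hd Z W
    _ = _ := by ring

theorem careResidual_limit {X : ℕ → Matrix (Fin n) (Fin n) ℝ} {Y : Matrix (Fin n) (Fin n) ℝ}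
    (hX : D.IsFPCARESequence X) (hY : IsUnit (D.Rc Y).det) (hlim : Tendsto X atTop (𝓝 Y)) :
    D.careResidual Y Y = 0 := by
  have hinv := D.tendsto_Rc_inv hY hlim
  have hlim' := hlim.comp (tendsto_add_atTop_nat 1)
  have hP {p q : ℕ} (f : Matrix (Fin n) (Fin n) ℝ → Matrix (Fin p) (Fin q) ℝ)
      (hf : Continuous f) : Tendsto (fun k => f (X k)) atTop (𝓝 (f Y)) :=
    (hf.tendsto Y).comp hlim
  have hLc := hP D.Lc (by unfold Lc Pi12; fun_prop)
  have hQc := hP D.Qc (by unfold Qc Pi11; fun_prop)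
  have hLt : Tendsto (fun k => (D.Lc (X k))ᵀ) atTop (𝓝 (D.Lc Y)ᵀ) :=
    (continuous_id.matrix_transpose.tendsto _).comp hLc
  have hB : Tendsto (fun _ : ℕ => D.B) atTop (𝓝 D.B) := tendsto_const_nhds
  have hBt : Tendsto (fun _ : ℕ => D.Bᵀ) atTop (𝓝 D.Bᵀ) := tendsto_const_nhds
  have hmul {p q s : ℕ} {f : ℕ → Matrix (Fin p) (Fin q) ℝ} {g : ℕ → Matrix (Fin q) (Fin s) ℝ}
      {F G} (hf : Tendsto f atTop (𝓝 F)) (hg : Tendsto g atTop (𝓝 G)) :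
      Tendsto (fun k => f k * g k) atTop (𝓝 (F * G)) :=
    ((continuous_fst.matrix_mul continuous_snd).tendsto (F, G)).comp (hf.prodMk_nhds hg)
  have hA : Tendsto (fun k => D.Ac (X k)) atTop (𝓝 (D.Ac Y)) :=
    tendsto_const_nhds.sub (hmul (hmul hB hinv) hLt)
  have hG : Tendsto (fun k => D.Gc (X k)) atTop (𝓝 (D.Gc Y)) := hmul (hmul hB hinv) hBt
  have hH : Tendsto (fun k => D.Hc (X k)) atTop (𝓝 (D.Hc Y)) :=
    hQc.sub (hmul (hmul hLc hinv) hLt)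
  have hAt : Tendsto (fun k => (D.Ac (X k))ᵀ) atTop (𝓝 (D.Ac Y)ᵀ) :=
    (continuous_id.matrix_transpose.tendsto _).comp hA
  have hres : Tendsto (fun k => D.careResidual (X k) (X (k + 1))) atTop
      (𝓝 (D.careResidual Y Y)) :=
    (((hmul hAt hlim').add (hmul hlim' hA)).sub (hmul (hmul hlim' hG) hlim')).add hH
  simp only [D.careResidual_succ hX] at hres
  exact tendsto_nhds_unique hres tendsto_const_nhds

theorem exists_geometric_error_bound {X : ℕ → Matrix (Fin n) (Fin n) ℝ} {Y : SymMat n}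
    (hX : D.IsFPCARESequence X) (hY : (Y : Matrix (Fin n) (Fin n) ℝ).PosSemidef)
    (hlim : Tendsto X atTop (𝓝 (Y : Matrix (Fin n) (Fin n) ℝ)))
    (hL : IsUnit (D.lyapOp Y))
    (hrho : complexSpectralRadius (Ring.inverse (D.lyapOp Y) * D.psiOp Y) < 1) :
    ∃ γ C : ℝ, 0 < γ ∧ γ < 1 ∧ 0 < C ∧
      ∀ᶠ k in atTop, ‖X k - (Y : Matrix (Fin n) (Fin n) ℝ)‖ ≤ C * γ ^ k := by
  -- Nonsingularity at the limit comes from `R > 0` and `Y ≥ 0`, not from the iterates.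
  have hR : IsUnit (D.Rc Y).det := (D.Rc_posDef hY).det_pos.ne'.isUnit
  let e : ℕ → SymMat n := fun k => ⟨X k, D.isSymm_of_isFPCARESequence hX k⟩ - Y
  have he : ∀ k, (e k : Matrix (Fin n) (Fin n) ℝ) = X k - Y := fun k => rfl
  have hnorm : ∀ k, ‖e k‖ = ‖X k - (Y : Matrix (Fin n) (Fin n) ℝ)‖ := fun k => rfl
  -- The linear part of the expansion; since both residuals vanish, it equals the quadratic
  -- remainder.
  let v : ℕ → SymMat n := fun k => D.lyapOp Y (e (k + 1)) + D.psiOp Y (e k)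
  have hv : ∀ k, (v k : Matrix (Fin n) (Fin n) ℝ)
      = (D.defect Y (e k) (e (k + 1)))ᵀ * (D.Rc (X k))⁻¹ * D.defect Y (e k) (e (k + 1)) := by
    intro k
    have hXk : (Y : Matrix (Fin n) (Fin n) ℝ) + e k = X k := by rw [he]; abel
    have hXk' : (Y : Matrix (Fin n) (Fin n) ℝ) + e (k + 1) = X (k + 1) := by rw [he]; abel
    have h := D.careResidual_add Y.2 (e k).2 (e (k + 1)).2 hR (by rw [hXk]; exact (hX.2 k).1)
    rw [hXk, hXk', D.careResidual_succ hX, D.careResidual_limit hX hR hlim, zero_add] at h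
    exact (sub_eq_zero.1 h.symm)
  let J := Ring.inverse (D.lyapOp Y)
  have hJ : ∀ z, J (D.lyapOp Y z) = z := fun z => by
    have := congrArg (fun f : Module.End ℝ (SymMat n) => f z) (Ring.inverse_mul_cancel _ hL)
    exact this
  obtain ⟨K, hK, hrem⟩ := D.exists_norm_remainder_le hR hlim
  obtain ⟨C, hC, hJC⟩ := J.exists_bound_of_finiteDimensional
  refine exists_geometric_bound (e := e) (w := fun k => J (v k)) (K := C * K)
    (J * D.psiOp Y) hrho ?_ ?_ ?_
  · rw [tendsto_zero_iff_norm_tendsto_zero]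
    simp only [hnorm]
    have := (hlim.sub_const (Y : Matrix (Fin n) (Fin n) ℝ)).norm
    simpa using this
  · intro k
    simp only [v, map_add, hJ, Module.End.mul_apply]
    abel
  · filter_upwards [hrem] with k hk
    calc ‖J (v k)‖ ≤ C * ‖v k‖ := hJC _
      _ ≤ C * (K * (‖e k‖ + ‖e (k + 1)‖) ^ 2) := by
        gcongr
        have := hk (e k) (e (k + 1))
        rw [← hv] at this
        exact this
      _ = _ := by ring

theorem exists_seminorm_le (N : Seminorm ℝ (Matrix (Fin n) (Fin n) ℝ)) :
    ∃ C : ℝ, 0 < C ∧ ∀ Z, N Z ≤ C * ‖Z‖ :=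
  N.exists_bound_of_finiteDimensional

end SCAREData

theorem mainTheorem3 {n m r : ℕ} (D : SCAREData n m r)
    (X : ℕ → Matrix (Fin n) (Fin n) ℝ) (Xhat : SymMat n)
    (hX : D.IsFPCARESequence X)
    (hXhat : (Xhat : Matrix (Fin n) (Fin n) ℝ).PosSemidef)
    (hmono : (∀ k, (X (k + 1) - X k).PosSemidef) ∨ (∀ k, (X k - X (k + 1)).PosSemidef))
    (hlim : Tendsto X atTop (𝓝 (Xhat : Matrix (Fin n) (Fin n) ℝ)))
    (hL : IsUnit (D.lyapOp Xhat))
    (hrho : complexSpectralRadius (Ring.inverse (D.lyapOp Xhat) * D.psiOp Xhat) < 1) :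
    ∃ γ : ℝ, 0 < γ ∧ γ < 1 ∧
      ∀ N : Seminorm ℝ (Matrix (Fin n) (Fin n) ℝ), (∀ Z, N Z = 0 → Z = 0) →
        limsup (fun k : ℕ =>
          (((N (X k - (Xhat : Matrix (Fin n) (Fin n) ℝ))) ^ (1 / (k : ℝ)) : ℝ) : EReal)) atTop
            ≤ (γ : EReal) := by
  obtain ⟨γ, C, hγ0, hγ1, hC, hbound⟩ := D.exists_geometric_error_bound hX hXhat hlim hL hrho
  refine ⟨γ, hγ0, hγ1, fun N _ => ?_⟩
  -- Changing the norm affects only the constant, which the `k`-th root removes, so one `γ` serves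
  -- every `N`.
  obtain ⟨C', hC', hN⟩ := SCAREData.exists_seminorm_le N
  refine limsup_root_le (mul_pos hC' hC) hγ0 (fun k => apply_nonneg N _) ?_
  filter_upwards [hbound] with k hk
  calc N (X k - (Xhat : Matrix (Fin n) (Fin n) ℝ)) ≤ _ := hN _
    _ ≤ C' * (C * γ ^ k) := mul_le_mul_of_nonneg_left hk hC'.le
    _ = _ := by ring
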